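/- Let $K$ be a field and let $L$ be a finite-dimensional Lie algebra over $K$. All Lie algebras $E$ below are finite-dimensional over $K$, and $Z(E)$ denotes the centre of $E$. A central extension of $L$ is a pair $(E,\varphi)$ where $\varphi\colon E\to L$ is a surjective homomorphism of Lie algebras with $\ker\varphi\subseteq Z(E)$. Put \[ Z^*(L)=\bigcap\{\varphi(Z(E)) \mid (E,\varphi)\text{ is a central extension of }L\}. \] Let $L\wedge L$ be the (nonabelian) exterior square of $L$, that is, the Lie algebra generated by the symbols $x\wedge y$ $(x,y\in L)$ subject to the relations \[ c(x\wedge y)=(cx)\wedge y=x\wedge(cy),\quad (x+x')\wedge y=x\wedge y+x'\wedge y,\quad x\wedge(y+y')=x\wedge y+x\wedge y', \] \[ [x,x']\wedge y=x\wedge[x',y]-x'\wedge[x,y],\qquad x\wedge[y,y']=[y',x]\wedge y-[y,x]\wedge y', \] \[ [x\wedge y,\;x'\wedge y']=-\,[y,x]\wedge[x',y'],\qquad x\wedge x=0 \] for all $c\in K$ and $x,x',y,y'\in L$. Let $Z^{\wedge}(L)=\{x\in L \mid x\wedge y=0\text{ for all }y\in L\}$ be the exterior centre of $L$. Then $Z^*(L)$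 and $Z^{\wedge}(L)$ are ideals of $L$ and \[ Z^*(L)=Z^{\wedge}(L). \] Moreover, $L$ is capable (that is, $L\cong E/Z(E)$ for some Lie algebra $E$) if and only if $Z^{\wedge}(L)=0$. -/

import Mathlib

universe u v

namespace LieCapability

section

variable (K : Type u) (L : Type v) [Field K] [LieRing L] [LieAlgebra K L]

/-- The defining relators of the exterior square `L ∧ L`, as elements of the free Lie algebra on
the symbols `x ∧ y`, where `x y : L`. -/
inductive ExteriorRelator : FreeLieAlgebra K (L × L) → Prop
  /-- `c (x ∧ y) = (c x) ∧ y` -/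
  | smul_left (c : K) (x y : L) : ExteriorRelator
      (c • FreeLieAlgebra.of K (x, y) - FreeLieAlgebra.of K (c • x, y))
  /-- `c (x ∧ y) = x ∧ (c y)` -/
  | smul_right (c : K) (x y : L) : ExteriorRelator
      (c • FreeLieAlgebra.of K (x, y) - FreeLieAlgebra.of K (x, c • y))
  /-- `(x + x') ∧ y = x ∧ y + x' ∧ y` -/
  | add_left (x x' y : L) : ExteriorRelator
      (FreeLieAlgebra.of K (x + x', y)
        - (FreeLieAlgebra.of K (x, y) + FreeLieAlgebra.of K (x', y)))
  /-- `x ∧ (y + y') = x ∧ y + x ∧ y'` -/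
  | add_right (x y y' : L) : ExteriorRelator
      (FreeLieAlgebra.of K (x, y + y')
        - (FreeLieAlgebra.of K (x, y) + FreeLieAlgebra.of K (x, y')))
  /-- `[x, x'] ∧ y = x ∧ [x', y] - x' ∧ [x, y]` -/
  | lie_left (x x' y : L) : ExteriorRelator
      (FreeLieAlgebra.of K (⁅x, x'⁆, y)
        - (FreeLieAlgebra.of K (x, ⁅x', y⁆) - FreeLieAlgebra.of K (x', ⁅x, y⁆)))
  /-- `x ∧ [y, y'] = [y', x] ∧ y - [y, x] ∧ y'` -/
  | lie_right (x y y' : L) : ExteriorRelator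
      (FreeLieAlgebra.of K (x, ⁅y, y'⁆)
        - (FreeLieAlgebra.of K (⁅y', x⁆, y) - FreeLieAlgebra.of K (⁅y, x⁆, y')))
  /-- `[x ∧ y, x' ∧ y'] = - ([y, x] ∧ [x', y'])` -/
  | lie_lie (x y x' y' : L) : ExteriorRelator
      (⁅FreeLieAlgebra.of K (x, y), FreeLieAlgebra.of K (x', y')⁆
        + FreeLieAlgebra.of K (⁅y, x⁆, ⁅x', y'⁆))
  /-- `x ∧ x = 0` -/
  | self (x : L) : ExteriorRelator (FreeLieAlgebra.of K (x, x))

/-- The ideal of the free Lie algebra on the symbols `x ∧ y` generated by the relators. -/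
noncomputable def exteriorIdeal : LieIdeal K (FreeLieAlgebra K (L × L)) :=
  LieSubmodule.lieSpan K (FreeLieAlgebra K (L × L)) {w | ExteriorRelator K L w}

/-- The (nonabelian) exterior square `L ∧ L` of a Lie algebra: the Lie algebra generated by the
symbols `x ∧ y` subject to the relations listed in `ExteriorRelator`. -/
abbrev ExteriorSquare : Type (max u v) :=
  FreeLieAlgebra K (L × L) ⧸ exteriorIdeal K L

variable {L}

/-- The element `x ∧ y` of the exterior square `L ∧ L`. -/
noncomputable def wedge (x y : L) : ExteriorSquare K L :=
  LieSubmodule.Quotient.mk (FreeLieAlgebra.of K (x, y))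

variable {K} in
theorem mk_eq_zero_of_relator {w : FreeLieAlgebra K (L × L)} (hw : ExteriorRelator K L w) :
    (LieSubmodule.Quotient.mk w : ExteriorSquare K L) = 0 :=
  LieSubmodule.Quotient.mk_eq_zero'.2 (LieSubmodule.subset_lieSpan hw)

theorem wedge_add_left (x x' y : L) : wedge K (x + x') y = wedge K x y + wedge K x' y :=
  sub_eq_zero.1 (mk_eq_zero_of_relator (.add_left x x' y))

theorem smul_wedge_left (c : K) (x y : L) : c • wedge K x y = wedge K (c • x) y :=
  sub_eq_zero.1 (mk_eq_zero_of_relator (.smul_left c x y))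

theorem wedge_lie_left (x x' y : L) :
    wedge K ⁅x, x'⁆ y = wedge K x ⁅x', y⁆ - wedge K x' ⁅x, y⁆ :=
  sub_eq_zero.1 (mk_eq_zero_of_relator (.lie_left x x' y))

theorem smul_wedge_right (c : K) (x y : L) : c • wedge K x y = wedge K x (c • y) :=
  sub_eq_zero.1 (mk_eq_zero_of_relator (.smul_right c x y))

/-- The exterior square maps to `L` by `x ∧ y ↦ [x, y]`; hence `x ∧ y = 0` forces `[x, y] = 0`. -/
theorem lie_eq_zero_of_wedge_eq_zero {x y : L} (h : wedge K x y = 0) : ⁅x, y⁆ = 0 := by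
  let f : FreeLieAlgebra K (L × L) →ₗ⁅K⁆ L := FreeLieAlgebra.lift K fun p => ⁅p.1, p.2⁆
  have hf : ∀ a b : L, f (FreeLieAlgebra.of K (a, b)) = ⁅a, b⁆ := fun a b => by
    simp [f]
  have hle : exteriorIdeal K L ≤ f.ker := by
    refine LieSubmodule.lieSpan_le.2 fun w hw => ?_
    rw [SetLike.mem_coe, LieHom.mem_ker]
    cases hw with
    | lie_right a b c =>
      simp only [map_sub, hf]
      rw [leibniz_lie a b c, ← lie_skew b a, ← lie_skew c a, neg_lie, neg_lie,
        ← lie_skew ⁅a, c⁆ b]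
      abel
    | lie_lie a b c d =>
      simp only [map_add, LieHom.map_lie, hf]
      rw [← lie_skew b a, neg_lie]
      abel
    | _ => simp [hf]
  have h0 := hle (LieSubmodule.Quotient.mk_eq_zero'.1 h)
  rwa [LieHom.mem_ker, hf] at h0

variable (L)

/-- The exterior centre `Z^∧(L)`: all `x : L` such that `x ∧ y = 0` for every `y : L`. -/
def exteriorCenter : LieIdeal K L where
  carrier := {x | ∀ y : L, wedge K x y = 0}
  add_mem' {a b} ha hb y := by rw [wedge_add_left, ha y, hb y, add_zero]
  zero_mem' y := by
    have h := smul_wedge_left K 0 (0 : L) y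
    rwa [zero_smul, zero_smul, eq_comm] at h
  smul_mem' c a ha y := by rw [← smul_wedge_left, ha y, smul_zero]
  lie_mem {z a} ha y := by
    have h := smul_wedge_right K 0 z (0 : L)
    rw [zero_smul, zero_smul, eq_comm] at h
    rw [wedge_lie_left, ha, lie_eq_zero_of_wedge_eq_zero K (ha y), h, sub_zero]

variable {K L}

/-- A homomorphism `φ : E → L` of Lie algebras is a central extension of `L` if it is surjective
and its kernel is contained in the centre of `E`. -/
structure IsCentralExtension {E : Type*} [LieRing E] [LieAlgebra K E] (φ : E →ₗ⁅K⁆ L) : Prop where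
  surjective : Function.Surjective φ
  ker_le_center : φ.ker ≤ LieAlgebra.center K E

variable (K L)

/-- The ideal `Z^*(L)`: the intersection of the images `φ(Z(E))` over all central extensions
`φ : E → L`, where `E` ranges over the finite-dimensional Lie algebras. -/
def epicenter : LieIdeal K L where
  carrier := {x | ∀ (E : Type (max u v)) [LieRing E] [LieAlgebra K E] [Module.Finite K E]
    (φ : E →ₗ⁅K⁆ L), IsCentralExtension φ → x ∈ φ '' (LieAlgebra.center K E : Set E)}
  add_mem' {a b} ha hb E _ _ _ φ hφ := by
    obtain ⟨s, hs, rfl⟩ := ha E φ hφ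
    obtain ⟨t, ht, rfl⟩ := hb E φ hφ
    exact ⟨s + t, add_mem hs ht, map_add φ s t⟩
  zero_mem' E _ _ _ φ _ := ⟨0, zero_mem _, map_zero φ⟩
  smul_mem' c a ha E _ _ _ φ hφ := by
    obtain ⟨s, hs, rfl⟩ := ha E φ hφ
    exact ⟨c • s, (LieAlgebra.center K E).smul_mem c hs, map_smul φ c s⟩
  lie_mem {z a} ha E _ _ _ φ hφ := by
    obtain ⟨s, hs, rfl⟩ := ha E φ hφ
    obtain ⟨t, rfl⟩ := hφ.surjective z
    exact ⟨⁅t, s⁆, (LieAlgebra.center K E).lie_mem hs, LieHom.map_lie φ t s⟩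

/-- `L` is capable if `L ≅ E / Z(E)` for some finite-dimensional Lie algebra `E`. -/
def IsCapable : Prop :=
  ∃ (E : Type (max u v)) (_ : LieRing E) (_ : LieAlgebra K E) (_ : Module.Finite K E),
    Nonempty (L ≃ₗ⁅K⁆ (E ⧸ LieAlgebra.center K E))

end

end LieCapability

namespace LieCapability

section CocycleExtension

variable {K L M : Type*} [Field K] [LieRing L] [LieAlgebra K L] [AddCommGroup M] [Module K M]

/-! In a central extension `φ : E → L` the bracket of `E` depends only on images in `L` and
satisfies the defining relations of `L ∧ L`. So if `φ a ∧ y = 0` for all `y`, then `a` is central,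
whence `Z^∧ ≤ Z^*` (`IsCentralExtension.lie_eq_zero_of_wedge_eq_zero`). Conversely, one extension
suffices: `∧` is itself a 2-cocycle, and the centre of the extension it defines projects into `Z^∧`
(`proj_mem_exteriorCenter`). If `Z^∧ = 0`, that centre is the kernel, so `L` is capable; if `L ≅ E /
Z(E)`, then `E → L` sends `Z(E)` to `0`, so `Z^* = 0`. -/

/-- An alternating bilinear map `L × L → M` satisfying the Jacobi-type identity of a `2`-cocycle
of `L` with coefficients in the trivial module `M`. -/
structure IsTrivialCocycle (B : L →ₗ[K] L →ₗ[K] M) : Prop where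
  self (x : L) : B x x = 0
  lie_left (x y z : L) : B ⁅x, y⁆ z = B x ⁅y, z⁆ - B y ⁅x, z⁆

theorem IsTrivialCocycle.skew {B : L →ₗ[K] L →ₗ[K] M} (hB : IsTrivialCocycle B) (x y : L) :
    B x y = -B y x := by
  have h := hB.self (x + y)
  simp only [map_add, LinearMap.add_apply, hB.self, zero_add, add_zero] at h
  exact eq_neg_of_add_eq_zero_right h

/-- The underlying space `L × M` of the central extension of `L` by `M` defined by a cocycle. -/
def CocycleExtension {B : L →ₗ[K] L →ₗ[K] M} (_ : IsTrivialCocycle B) : Type _ := L × M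

namespace CocycleExtension

variable {B : L →ₗ[K] L →ₗ[K] M} (hB : IsTrivialCocycle B)

instance : AddCommGroup (CocycleExtension hB) := inferInstanceAs (AddCommGroup (L × M))

instance : Module K (CocycleExtension hB) := inferInstanceAs (Module K (L × M))

instance [Module.Finite K L] [Module.Finite K M] : Module.Finite K (CocycleExtension hB) :=
  inferInstanceAs (Module.Finite K (L × M))

/-- The Jacobi identity in the second coordinate is exactly the cocycle identity of `B`. -/
instance : LieRing (CocycleExtension hB) where
  bracket x y := (⁅x.1, y.1⁆, B x.1 y.1)
  add_lie x y z := by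
    refine Prod.ext (add_lie x.1 y.1 z.1) ?_
    change B (x.1 + y.1) z.1 = B x.1 z.1 + B y.1 z.1
    rw [map_add, LinearMap.add_apply]
  lie_add x y z := Prod.ext (lie_add x.1 y.1 z.1) (map_add (B x.1) y.1 z.1)
  lie_self x := Prod.ext (lie_self x.1) (hB.self x.1)
  leibniz_lie x y z := by
    refine Prod.ext (leibniz_lie x.1 y.1 z.1) ?_
    change B x.1 ⁅y.1, z.1⁆ = B ⁅x.1, y.1⁆ z.1 + B y.1 ⁅x.1, z.1⁆
    rw [hB.lie_left, sub_add_cancel]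

instance : LieAlgebra K (CocycleExtension hB) where
  lie_smul c x y := Prod.ext (lie_smul c x.1 y.1) (map_smul (B x.1) c y.1)

/-- The projection of the extension defined by a cocycle onto `L`. -/
def proj : CocycleExtension hB →ₗ⁅K⁆ L where
  toFun x := x.1
  map_add' _ _ := rfl
  map_smul' _ _ := rfl
  map_lie' := rfl

theorem isCentralExtension_proj : IsCentralExtension (proj hB) where
  surjective x := ⟨(x, 0), rfl⟩
  ker_le_center x hx y := by
    replace hx : x.1 = 0 := hx
    refine Prod.ext (?_ : ⁅y.1, x.1⁆ = 0) (?_ : B y.1 x.1 = 0)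
    · rw [hx, lie_zero]
    · rw [hx, map_zero]

/-- The second coordinate of the bracket with `(y, 0)` is a value of `B`. -/
theorem apply_eq_zero_of_mem_center {x : CocycleExtension hB}
    (hx : x ∈ LieAlgebra.center K (CocycleExtension hB)) (y : L) : B (proj hB x) y = 0 := by
  have h : B y x.1 = 0 := congrArg Prod.snd (hx (y, 0))
  rw [hB.skew]
  exact neg_eq_zero.2 h

end CocycleExtension

end CocycleExtension

section

variable (K : Type u) (L : Type v) [Field K] [LieRing L] [LieAlgebra K L]

theorem wedge_add_right (x y y' : L) : wedge K x (y + y') = wedge K x y + wedge K x y' :=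
  sub_eq_zero.1 (mk_eq_zero_of_relator (.add_right x y y'))

theorem wedge_self (x : L) : wedge K x x = 0 :=
  mk_eq_zero_of_relator (.self x)

/-- The map `(x, y) ↦ x ∧ y` as a bilinear map. -/
noncomputable def wedgeBilin : L →ₗ[K] L →ₗ[K] ExteriorSquare K L :=
  LinearMap.mk₂ K (wedge K) (wedge_add_left K) (fun c x y => (smul_wedge_left K c x y).symm)
    (wedge_add_right K L) (fun c x y => (smul_wedge_right K c x y).symm)

/-- The subspace of the exterior square spanned by the elements `x ∧ y`. -/
noncomputable abbrev wedgeSpan : Submodule K (ExteriorSquare K L) :=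
  LinearMap.range (TensorProduct.lift (wedgeBilin K L))

/-- The map `(x, y) ↦ x ∧ y` as a bilinear map into the span of its values. -/
noncomputable def wedgeSpanBilin : L →ₗ[K] L →ₗ[K] wedgeSpan K L :=
  TensorProduct.curry (TensorProduct.lift (wedgeBilin K L)).rangeRestrict

/-- Only the vector space structure of the span matters here. As the image of `L ⊗ L` it is
finite-dimensional when `L` is. -/
theorem isTrivialCocycle_wedgeSpanBilin : IsTrivialCocycle (wedgeSpanBilin K L) where
  self x := Subtype.ext (wedge_self K L x)
  lie_left x y z := Subtype.ext (wedge_lie_left K x y z)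

/-- The central extension of `L` by the span of the elements `x ∧ y` with cocycle `∧`. -/
abbrev WedgeExtension : Type (max u v) :=
  CocycleExtension (isTrivialCocycle_wedgeSpanBilin K L)

variable {K L} in
theorem proj_mem_exteriorCenter {x : WedgeExtension K L}
    (hx : x ∈ LieAlgebra.center K (WedgeExtension K L)) :
    CocycleExtension.proj _ x ∈ exteriorCenter K L := fun y =>
  congrArg Subtype.val (CocycleExtension.apply_eq_zero_of_mem_center _ hx y)

variable {K L}

/-- Two lifts of the same element differ by a central element. -/
theorem IsCentralExtension.lie_eq_lie {E : Type*} [LieRing E] [LieAlgebra K E] {φ : E →ₗ⁅K⁆ L}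
    (hφ : IsCentralExtension φ) {a a' b b' : E} (ha : φ a = φ a') (hb : φ b = φ b') :
    ⁅a, b⁆ = ⁅a', b'⁆ := by
  have hl : ⁅b, a - a'⁆ = 0 :=
    hφ.ker_le_center (by rw [LieHom.mem_ker, map_sub, ha, sub_self]) b
  have hr : ⁅a', b - b'⁆ = 0 :=
    hφ.ker_le_center (by rw [LieHom.mem_ker, map_sub, hb, sub_self]) a'
  rw [lie_sub, sub_eq_zero] at hl hr
  rw [← hr, ← lie_skew a b, hl, lie_skew]

/-- The commutator map of a central extension factors through the exterior square. -/
theorem IsCentralExtension.lie_eq_zero_of_wedge_eq_zero {E : Type*} [LieRing E] [LieAlgebra K E]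
    {φ : E →ₗ⁅K⁆ L} (hφ : IsCentralExtension φ) {a b : E} (h : wedge K (φ a) (φ b) = 0) :
    ⁅a, b⁆ = 0 := by
  -- A set-theoretic section is enough: by `lie_eq_lie` the map `f` does not depend on it, so each
  -- relator can be checked on arbitrary lifts, where it is an identity in `E`.
  obtain ⟨s, hs⟩ := hφ.surjective.hasRightInverse
  let f : FreeLieAlgebra K (L × L) →ₗ⁅K⁆ E := FreeLieAlgebra.lift K fun p => ⁅s p.1, s p.2⁆
  have hf (a b : E) : f (FreeLieAlgebra.of K (φ a, φ b)) = ⁅a, b⁆ := by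
    simpa [f] using hφ.lie_eq_lie (hs _) (hs _)
  have hle : exteriorIdeal K L ≤ f.ker := by
    refine LieSubmodule.lieSpan_le.2 fun w hw => ?_
    rw [SetLike.mem_coe, LieHom.mem_ker]
    induction hw with
    | smul_left c x y =>
      obtain ⟨x, rfl⟩ := hφ.surjective x
      obtain ⟨y, rfl⟩ := hφ.surjective y
      rw [← map_smul φ, map_sub, map_smul, hf, hf, smul_lie, sub_self]
    | smul_right c x y =>
      obtain ⟨x, rfl⟩ := hφ.surjective x
      obtain ⟨y, rfl⟩ := hφ.surjective y
      rw [← map_smul φ, map_sub, map_smul, hf, hf, lie_smul, sub_self]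
    | add_left x x' y =>
      obtain ⟨x, rfl⟩ := hφ.surjective x
      obtain ⟨x', rfl⟩ := hφ.surjective x'
      obtain ⟨y, rfl⟩ := hφ.surjective y
      rw [← map_add φ, map_sub, map_add f, hf, hf, hf, add_lie, sub_self]
    | add_right x y y' =>
      obtain ⟨x, rfl⟩ := hφ.surjective x
      obtain ⟨y, rfl⟩ := hφ.surjective y
      obtain ⟨y', rfl⟩ := hφ.surjective y'
      rw [← map_add φ, map_sub, map_add f, hf, hf, hf, lie_add, sub_self]
    | lie_left x x' y =>
      obtain ⟨x, rfl⟩ := hφ.surjective x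
      obtain ⟨x', rfl⟩ := hφ.surjective x'
      obtain ⟨y, rfl⟩ := hφ.surjective y
      simp only [← LieHom.map_lie φ, map_sub, hf]
      rw [lie_lie, sub_self]
    | lie_right x y y' =>
      obtain ⟨x, rfl⟩ := hφ.surjective x
      obtain ⟨y, rfl⟩ := hφ.surjective y
      obtain ⟨y', rfl⟩ := hφ.surjective y'
      simp only [← LieHom.map_lie φ, map_sub, hf]
      rw [leibniz_lie x y y', ← lie_skew y x, ← lie_skew y' x, neg_lie, neg_lie,
        ← lie_skew ⁅x, y'⁆ y]
      abel
    | lie_lie x y x' y' =>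
      obtain ⟨x, rfl⟩ := hφ.surjective x
      obtain ⟨y, rfl⟩ := hφ.surjective y
      obtain ⟨x', rfl⟩ := hφ.surjective x'
      obtain ⟨y', rfl⟩ := hφ.surjective y'
      simp only [← LieHom.map_lie φ, map_add, LieHom.map_lie f, hf]
      rw [← lie_skew y x, neg_lie, add_neg_cancel]
    | self x =>
      obtain ⟨x, rfl⟩ := hφ.surjective x
      rw [hf, lie_self]
  have h0 := hle (LieSubmodule.Quotient.mk_eq_zero'.1 h)
  rwa [LieHom.mem_ker, hf] at h0

variable (K L)

theorem exteriorCenter_le_epicenter : exteriorCenter K L ≤ epicenter K L := by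
  intro x hx E _ _ _ φ hφ
  obtain ⟨a, rfl⟩ := hφ.surjective x
  refine ⟨a, fun b => ?_, rfl⟩
  rw [← lie_skew, hφ.lie_eq_zero_of_wedge_eq_zero (hx (φ b)), neg_zero]

theorem epicenter_eq_exteriorCenter [Module.Finite K L] :
    epicenter K L = exteriorCenter K L := by
  refine le_antisymm (fun x hx => ?_) (exteriorCenter_le_epicenter K L)
  -- The wedge extension is finite-dimensional and lives in the universe `epicenter` ranges over, so
  -- it is one of the extensions in the intersection.
  obtain ⟨a, ha, rfl⟩ :=
    hx (WedgeExtension K L) _ (CocycleExtension.isCentralExtension_proj _)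
  exact proj_mem_exteriorCenter ha

variable {K L}

/-- A central extension whose kernel is the whole centre exhibits `L` as a quotient by the
centre. -/
theorem nonempty_equiv_quotient_center {E : Type*} [LieRing E] [LieAlgebra K E] {φ : E →ₗ⁅K⁆ L}
    (hsurj : Function.Surjective φ) (hker : φ.ker = LieAlgebra.center K E) :
    Nonempty (L ≃ₗ⁅K⁆ (E ⧸ LieAlgebra.center K E)) := by
  rw [← hker]
  exact ⟨((φ.quotKerEquivRange.trans (LieEquiv.ofEq _ _ (by
    rw [φ.range_eq_top.2 hsurj]))).trans LieSubalgebra.topEquiv).symm⟩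

theorem isCapable_of_exteriorCenter_eq_bot [Module.Finite K L] (h : exteriorCenter K L = ⊥) :
    IsCapable K L := by
  have hφ := CocycleExtension.isCentralExtension_proj (isTrivialCocycle_wedgeSpanBilin K L)
  refine ⟨WedgeExtension K L, inferInstance, inferInstance, inferInstance,
    nonempty_equiv_quotient_center hφ.surjective (le_antisymm hφ.ker_le_center fun x hx => ?_)⟩
  rw [LieHom.mem_ker, ← LieSubmodule.mem_bot (R := K) (L := L), ← h]
  exact proj_mem_exteriorCenter hx

theorem IsCapable.epicenter_eq_bot (h : IsCapable K L) : epicenter K L = ⊥ := by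
  obtain ⟨E, _, _, _, ⟨e⟩⟩ := h
  let φ : E →ₗ⁅K⁆ L :=
    { toFun x := e.symm (LieSubmodule.Quotient.mk x)
      map_add' x y := e.symm.toLieHom.map_add (LieSubmodule.Quotient.mk x) (LieSubmodule.Quotient.mk y)
      map_smul' c x := e.symm.toLieHom.map_smul c (LieSubmodule.Quotient.mk x)
      map_lie' {x y} := by rw [LieSubmodule.Quotient.mk_bracket, LieEquiv.map_lie] }
  have hker (x : E) : φ x = 0 ↔ x ∈ LieAlgebra.center K E :=
    (map_eq_zero_iff e.symm e.symm.injective).trans LieSubmodule.Quotient.mk_eq_zero'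
  have hφ : IsCentralExtension φ :=
    ⟨e.symm.surjective.comp (LieSubmodule.Quotient.surjective_mk' _), fun x hx => (hker x).1 hx⟩
  refine (LieSubmodule.eq_bot_iff _).2 fun x hx => ?_
  obtain ⟨a, ha, rfl⟩ := hx E φ hφ
  exact (hker a).2 ha

end

end LieCapability

theorem lemma6 (K : Type u) (L : Type v) [Field K] [LieRing L] [LieAlgebra K L]
    [Module.Finite K L] :
    LieCapability.epicenter K L = LieCapability.exteriorCenter K L ∧
      (LieCapability.IsCapable K L ↔ LieCapability.exteriorCenter K L = ⊥) :=
  ⟨LieCapability.epicenter_eq_exteriorCenter K L,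
    fun h => LieCapability.epicenter_eq_exteriorCenter K L ▸ h.epicenter_eq_bot,
    LieCapability.isCapable_of_exteriorCenter_eq_bot⟩
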